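/- Let $k=\mathbb{R}$ or $k=\mathbb{C}$, and let $n\ge 2$ be an integer. The commuting graph $\Gamma(\mathrm{Mat}_{n\times n}(k))$ has as vertices the non-scalar $n\times n$ matrices over $k$ (a matrix is scalar if it is a constant multiple of the identity), with an edge between two distinct vertices $A$ and $B$ if and only if $AB=BA$. For non-scalar $A,B$ let $d(A,B)\in\{0,1,2,\dots\}\cup\{\infty\}$ be their distance in this graph ($\infty$ if they lie in different components); if $A$ or $B$ is scalar, let $d(A,B)=0$ if $A=B$ and $d(A,B)=1$ otherwise. Then $$\{(A,B)\;|\; d(A,B)\le 3\}\subset \mathrm{Mat}_{n\times n}(k)^2$$ has Lebesgue measure $0$, where $\mathrm{Mat}_{n\times n}(k)^2$ is identified with $k^{2n^2}$. Moreover, if $n\ge 3$, then a random pair has commuting distance $4$: $d(A,B)=4$ for Lebesgue-almost every pair $(A,B)\in\mathrm{Mat}_{n\times n}(k)^2$. -/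

import Mathlib

open MeasureTheory

/-- A square matrix is scalar if it is a constant multiple of the identity matrix. -/
def IsScalarMatrix {k : Type*} [Field k] {n : ℕ} (A : Matrix (Fin n) (Fin n) k) : Prop :=
  ∃ c : k, A = c • (1 : Matrix (Fin n) (Fin n) k)

/-- The commuting graph: the vertices are the non-scalar `n × n` matrices over `k`, and two
distinct vertices are adjacent if and only if they commute. -/
def commutingGraph (k : Type*) [Field k] (n : ℕ) :
    SimpleGraph {A : Matrix (Fin n) (Fin n) k // ¬ IsScalarMatrix A} where
  Adj A B := A ≠ B ∧ A.1 * B.1 = B.1 * A.1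
  symm := ⟨fun _ _ h => ⟨h.1.symm, h.2.symm⟩⟩
  loopless := ⟨fun _ h => h.1 rfl⟩

open Classical in
/-- The commuting distance: the (extended) graph distance in the commuting graph if both matrices
are non-scalar (so `⊤` between different components); if one of them is scalar, it is `0` or `1`
according to whether the matrices are equal or not. -/
noncomputable def commutingDist {k : Type*} [Field k] {n : ℕ}
    (A B : Matrix (Fin n) (Fin n) k) : ℕ∞ :=
  if h : ¬ IsScalarMatrix A ∧ ¬ IsScalarMatrix B then
    (commutingGraph k n).edist ⟨A, h.1⟩ ⟨B, h.2⟩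
  else if A = B then 0 else 1

/-- The distance-`d` commuting set. -/
def commutingSet (k : Type*) [Field k] (n : ℕ) (d : ℕ∞) :
    Set (Matrix (Fin n) (Fin n) k × Matrix (Fin n) (Fin n) k) :=
  {p | commutingDist p.1 p.2 ≤ d}

/-- The measure on `n × n` matrices obtained by identifying them with the families of their
entries; over `ℝ` and `ℂ` this is Lebesgue measure on `ℝ ^ (n * n)` and `ℂ ^ (n * n)`. -/
noncomputable instance matrixMeasureSpace (k : Type*) [MeasureSpace k] (n : ℕ) :
    MeasureSpace (Matrix (Fin n) (Fin n) k) :=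
  inferInstanceAs (MeasureSpace (Fin n → Fin n → k))

/-!
Two ideas give the two bounds on the commuting distance.

*Distance at most three is a null condition.* If `d(A, B) ≤ 3` for non-scalar `A` and `B`, there are
non-scalar `C`, `D` such that `A, C, D, B` commute consecutively (`CommutingChain`). Such pairs form
a closed set, since `C` and `D` may be normalized to lie in a compact set
(`isClosed_commutingChain`). Almost every matrix has simple spectrum over `ℂ`, because
`det χ_A'(A)` is a nonzero polynomial in the entries. For `A` and `B` with simple spectrum, `C` is
diagonal in the eigenbasis of `A`, and `D` in that of `B`. If `W` is the matrix between the two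
eigenbases and `e` is the projection on a spectral subspace of `C`, then `W⁻¹ e W` commutes with a
non-scalar diagonal matrix, hence has a vanishing off-diagonal entry. When `B` is replaced by its
conjugate by a random `g`, the matrix `W` depends linearly on `g`, so that this is one of finitely
many nontrivial polynomial conditions on `g` (`ae_not_commutingChain_conj`). Conjugation by a fixed
invertible matrix preserves null sets, and Fubini's theorem on triples `(A, B, g)` shows that
almost no pair is joined by such a chain (`ae_not_commutingChain`).

*Distance at most four holds for all pairs when `n ≥ 3`.* If `A` has an eigenvalue in the field, the
product `v wᵀ` of a right and a left eigenvector commutes with `A`; for a real matrix without real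
eigenvalues, the real part of such a product does, and has rank at most two. Take such matrices
`P` for `A` and `Q` for `B`. If their ranks add up to less than `n`, then `x yᵀ`, with `x` in both
kernels and `y` in both left kernels, commutes with `P` and `Q`
(`exists_nonscalar_commute_of_card_lt`). As a real matrix of odd size has a real eigenvalue, the only
case left is that of two real matrices of size four. There `P` acts as a scalar on its image, and so
does `Q`. If the images are complementary, then `P` and `Q` are described by a pair of maps in
opposite directions between two planes, and an explicit non-scalar endomorphism of this pair
commutes with both. The case of complementary kernels is its transpose, and in all
other cases `x yᵀ` is again available (`exists_nonscalar_commute_four`).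
-/

/-! ### Null sets of matrices -/

section measure

variable {k : Type*} [NontriviallyNormedField k] [ProperSpace k]
  [SecondCountableTopology k] [MeasureSpace k] [BorelSpace k]
  [(volume : Measure k).IsAddHaarMeasure] {n : ℕ}

instance matrixBorelSpace : BorelSpace (Matrix (Fin n) (Fin n) k) :=
  inferInstanceAs (BorelSpace (Fin n → Fin n → k))

instance matrixSecondCountableTopology :
    SecondCountableTopology (Matrix (Fin n) (Fin n) k) :=
  inferInstanceAs (SecondCountableTopology (Fin n → Fin n → k))

instance matrixLocallyCompactSpace : LocallyCompactSpace (Matrix (Fin n) (Fin n) k) :=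
  inferInstanceAs (LocallyCompactSpace (Fin n → Fin n → k))

instance matrixVolumeIsAddHaarMeasure :
    (volume : Measure (Matrix (Fin n) (Fin n) k)).IsAddHaarMeasure :=
  have : (volume : Measure (Fin n → k)).IsAddHaarMeasure := Measure.pi.isAddHaarMeasure _
  Measure.pi.isAddHaarMeasure (fun _ : Fin n => (volume : Measure (Fin n → k)))

theorem Matrix.ae_mem_of_ae_linearMap_mem
    (L : Matrix (Fin n) (Fin n) k →ₗ[k] Matrix (Fin n) (Fin n) k)
    (h : Function.Surjective L) {s : Set (Matrix (Fin n) (Fin n) k)} (hs : MeasurableSet s)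
    (H : ∀ᵐ x, L x ∈ s) : ∀ᵐ y, y ∈ s :=
  have : (volume : Measure (Fin n → Fin n → k)).IsAddHaarMeasure :=
    matrixVolumeIsAddHaarMeasure
  (ae_comp_linearMap_mem_iff (E := Fin n → Fin n → k) (F := Fin n → Fin n → k) L
    (volume : Measure (Fin n → Fin n → k)) (volume : Measure (Fin n → Fin n → k)) h hs).1 H

variable [NullSingletonClass (volume : Measure k)] [NormedAlgebra k ℂ]

/-- A nonzero complex polynomial in the entries is nonzero at almost every matrix over `k`. On each
line through a point where it does not vanish it has finitely many zeros, and Fubini's theorem,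
applied to the contractions towards that point, gives the result. -/
theorem MvPolynomial.ae_eval_algebraMap_ne_zero {p : MvPolynomial (Fin n × Fin n) ℂ}
    (hp : p ≠ 0) :
    ∀ᵐ A : Matrix (Fin n) (Fin n) k,
      p.eval (fun ij => algebraMap k ℂ (A ij.1 ij.2)) ≠ 0 := by
  have hinj : Function.Injective (algebraMap k ℂ) := (algebraMap k ℂ).injective
  have hinf : Infinite k := inferInstance
  set f : Matrix (Fin n) (Fin n) k → ℂ :=
    fun A => p.eval (fun ij => algebraMap k ℂ (A ij.1 ij.2)) with hf
  have hfc : Continuous f := by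
    refine (MvPolynomial.continuous_eval p).comp (continuous_pi fun ij => ?_)
    exact (continuous_algebraMap k ℂ).comp (by fun_prop)
  obtain ⟨e, he⟩ : ∃ e, f e ≠ 0 := by
    by_contra! h
    refine hp (MvPolynomial.funext_set (fun _ => Set.range (algebraMap k ℂ))
      (fun _ => Set.infinite_range_of_injective hinj) fun x hx => ?_)
    choose y hy using fun i => hx i trivial
    have := h (fun i j => y (i, j))
    simpa [hf, hy] using this
  -- On the line through `e` and `x`, `f` is a polynomial that does not vanish at `e`.
  have hline : ∀ x : Matrix (Fin n) (Fin n) k, ∀ᵐ t : k, f (x + t • (e - x)) ≠ 0 := by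
    intro x
    set q : Polynomial ℂ := MvPolynomial.aeval (fun ij : Fin n × Fin n =>
      Polynomial.C (algebraMap k ℂ (x ij.1 ij.2)) +
        Polynomial.X * Polynomial.C (algebraMap k ℂ ((e - x) ij.1 ij.2))) p with hq
    have hqe : ∀ t : k, q.eval (algebraMap k ℂ t) = f (x + t • (e - x)) := by
      intro t
      rw [hq, ← Polynomial.coe_evalRingHom, MvPolynomial.aeval_def, MvPolynomial.hom_eval₂, hf]
      simp only [MvPolynomial.eval, MvPolynomial.coe_eval₂Hom]
      congr 1
      · ext; simp
      · ext ij; simp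
    have hq0 : q ≠ 0 := by
      intro h0
      have := hqe 1
      rw [h0] at this
      simp at this
      exact he this.symm
    have hfin : {t : k | ¬ f (x + t • (e - x)) ≠ 0}.Finite := by
      refine Set.Finite.subset (Set.Finite.preimage hinj.injOn
        (q.rootSet_finite ℂ)) fun t ht => ?_
      simp only [ne_eq, not_not, Set.mem_ofPred_eq] at ht
      simp [Polynomial.mem_rootSet, hq0, hqe, ht]
    exact hfin.measure_zero _
  have hmeas : MeasurableSet {z : Matrix (Fin n) (Fin n) k × k |
      f (z.1 + z.2 • (e - z.1)) ≠ 0} := by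
    refine (isOpen_ne_fun (hfc.comp ?_) continuous_const).measurableSet
    fun_prop
  have h1 := (Measure.ae_ae_comm (μ := (volume : Measure (Matrix (Fin n) (Fin n) k)))
    (ν := (volume : Measure k)) (p := fun x t => f (x + t • (e - x)) ≠ 0) hmeas).1
    (ae_of_all _ hline)
  obtain ⟨t, ht, ht1⟩ := (h1.and (Measure.ae_ne volume (1 : k))).exists
  have hs : MeasurableSet {y | f (y + t • e) ≠ 0} :=
    (isOpen_ne_fun (hfc.comp (by fun_prop)) continuous_const).measurableSet
  have h2 := Matrix.ae_mem_of_ae_linearMap_mem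
    ((1 - t) • (LinearMap.id : Matrix (Fin n) (Fin n) k →ₗ[k] _)) (fun y =>
      ⟨(1 - t)⁻¹ • y, by
        rw [LinearMap.smul_apply, LinearMap.id_apply, smul_smul,
          mul_inv_cancel₀ (sub_ne_zero.2 ht1.symm), one_smul]⟩) hs (by
      filter_upwards [ht] with x hx
      convert hx using 2
      simp [sub_smul, smul_sub]; abel)
  have h3 := (measurePreserving_add_right (volume : Measure (Matrix (Fin n) (Fin n) k))
    (-(t • e))).quasiMeasurePreserving.ae h2
  filter_upwards [h3] with x hx
  simpa using hx

theorem Matrix.ae_det_ne_zero : ∀ᵐ g : Matrix (Fin n) (Fin n) k, g.det ≠ 0 := by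
  filter_upwards [MvPolynomial.ae_eval_algebraMap_ne_zero (k := k)
    (Matrix.det_mvPolynomialX_ne_zero (Fin n) ℂ)] with g hg h0
  refine hg ?_
  have h1 : (Matrix.mvPolynomialX (Fin n) (Fin n) ℂ).map
      (MvPolynomial.eval fun ij : Fin n × Fin n => algebraMap k ℂ (g ij.1 ij.2)) =
        g.map (algebraMap k ℂ) :=
    Matrix.mvPolynomialX_map_eval₂ (RingHom.id ℂ) (g.map (algebraMap k ℂ))
  rw [RingHom.map_det, RingHom.mapMatrix_apply, h1, ← RingHom.mapMatrix_apply,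
    ← RingHom.map_det, h0, map_zero]

/-- Conjugating the second matrix by a random matrix `g` (up to the factor `det g`) preserves the
measure class, so a property of pairs may be checked on such conjugates. -/
theorem Matrix.ae_mem_of_ae_conj_mem
    {s : Set (Matrix (Fin n) (Fin n) k × Matrix (Fin n) (Fin n) k)} (hs : MeasurableSet s)
    (H : ∀ᵐ p : Matrix (Fin n) (Fin n) k × Matrix (Fin n) (Fin n) k,
      ∀ᵐ g : Matrix (Fin n) (Fin n) k, (p.1, g * p.2 * g.adjugate) ∈ s) :
    ∀ᵐ p, p ∈ s := by
  have hcont : Continuous fun z : (Matrix (Fin n) (Fin n) k × Matrix (Fin n) (Fin n) k) ×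
      Matrix (Fin n) (Fin n) k => (z.1.1, z.2 * z.1.2 * z.2.adjugate) := by
    have := (continuous_snd (X := Matrix (Fin n) (Fin n) k × Matrix (Fin n) (Fin n) k)
      (Y := Matrix (Fin n) (Fin n) k)).matrix_adjugate
    fun_prop
  have hswap := (Measure.ae_ae_comm
    (μ := (volume : Measure (Matrix (Fin n) (Fin n) k × Matrix (Fin n) (Fin n) k)))
    (ν := (volume : Measure (Matrix (Fin n) (Fin n) k)))
    (p := fun p g => (p.1, g * p.2 * g.adjugate) ∈ s) (hcont.measurable hs)).1 H
  obtain ⟨g, hg, hdet⟩ := (hswap.and Matrix.ae_det_ne_zero).exists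
  refine (Measure.ae_prod_iff_ae_ae hs).2 ?_
  filter_upwards [Measure.ae_ae_of_ae_prod hg] with A hA
  have hsA : MeasurableSet {B | (A, B) ∈ s} := measurable_prodMk_left hs
  refine Matrix.ae_mem_of_ae_linearMap_mem
    (LinearMap.mulRight k g.adjugate ∘ₗ LinearMap.mulLeft k g) (fun B => ?_) hsA hA
  refine ⟨g.det⁻¹ • (g.adjugate * B * (g.det⁻¹ • g)), ?_⟩
  simp only [LinearMap.comp_apply, LinearMap.mulLeft_apply, LinearMap.mulRight_apply,
    Matrix.mul_smul, Matrix.smul_mul, Matrix.mul_assoc, Matrix.mul_adjugate, Matrix.mul_one]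
  rw [← Matrix.mul_assoc g, Matrix.mul_adjugate]
  simp [smul_smul, hdet]

end measure

/-! ### Commuting chains form a closed set -/

section chain

variable {k : Type*} {n : ℕ}

/-- Two matrices are linked if they can be joined by a chain of consecutively commuting matrices
whose two intermediate terms are not scalar. -/
def CommutingChain [Field k] (A B : Matrix (Fin n) (Fin n) k) : Prop :=
  ∃ C D : Matrix (Fin n) (Fin n) k, ¬ IsScalarMatrix C ∧ ¬ IsScalarMatrix D ∧
    Commute A C ∧ Commute C D ∧ Commute D B

/-- A compact set of non-scalar matrices meeting every class of non-scalar matrices modulo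
`C ↦ a • C + b • 1`, `a ≠ 0`. -/
def normalizedMatrices (k : Type*) [NormedField k] (n : ℕ) (i₀ : Fin n) :
    Set (Matrix (Fin n) (Fin n) k) :=
  {C | C i₀ i₀ = 0 ∧ (∀ i j, ‖C i j‖ ≤ 1) ∧ ∃ i j, C i j = 1}

theorem not_isScalarMatrix_of_mem_normalizedMatrices [NormedField k] {i₀ : Fin n}
    {C : Matrix (Fin n) (Fin n) k} (hC : C ∈ normalizedMatrices k n i₀) :
    ¬ IsScalarMatrix C := by
  rintro ⟨c, rfl⟩
  obtain ⟨h0, -, i, j, hij⟩ := hC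
  have : c = 0 := by simpa using h0
  simp [this] at hij

theorem isCompact_normalizedMatrices [NormedField k] [ProperSpace k] (i₀ : Fin n) :
    IsCompact (normalizedMatrices k n i₀) := by
  have hcpt : IsCompact (Set.univ.pi fun _ : Fin n => Set.univ.pi fun _ : Fin n =>
      Metric.closedBall (0 : k) 1) :=
    isCompact_univ_pi fun _ => isCompact_univ_pi fun _ => isCompact_closedBall 0 1
  refine hcpt.of_isClosed_subset (t := normalizedMatrices k n i₀) ?_ fun C hC i _ j _ => ?_
  · have h : normalizedMatrices k n i₀ = {C | C i₀ i₀ = 0} ∩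
        ((⋂ i, ⋂ j, {C | ‖C i j‖ ≤ 1}) ∩ ⋃ i, ⋃ j, {C | C i j = 1}) := by
      ext C; simp [normalizedMatrices]
    rw [h]
    refine (isClosed_eq (by fun_prop) (by fun_prop)).inter
      (IsClosed.inter (isClosed_iInter fun i => isClosed_iInter fun j => ?_)
      (isClosed_iUnion_of_finite fun i => isClosed_iUnion_of_finite fun j => ?_))
    · exact isClosed_le (by fun_prop) (by fun_prop)
    · exact isClosed_eq (by fun_prop) (by fun_prop)
  · simpa using hC.2.1 i j

theorem exists_normalized [NormedField k] (i₀ : Fin n)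
    {C : Matrix (Fin n) (Fin n) k} (hC : ¬ IsScalarMatrix C) :
    ∃ C' ∈ normalizedMatrices k n i₀, ∀ A, Commute A C → Commute A C' := by
  have : Nonempty (Fin n) := ⟨i₀⟩
  set D := C - C i₀ i₀ • (1 : Matrix (Fin n) (Fin n) k) with hD
  obtain ⟨ij, hij⟩ := Finite.exists_max fun ij : Fin n × Fin n => ‖D ij.1 ij.2‖
  have hne : D ij.1 ij.2 ≠ 0 := by
    intro h0
    refine hC ⟨C i₀ i₀, sub_eq_zero.1 (?_ : D = 0)⟩
    ext i j
    simpa [h0] using hij (i, j)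
  refine ⟨(D ij.1 ij.2)⁻¹ • D, ⟨by simp [hD], fun i j => ?_, ij.1, ij.2, ?_⟩, fun A hA => ?_⟩
  · rw [Matrix.smul_apply, smul_eq_mul, norm_mul, norm_inv, inv_mul_le_one₀ (norm_pos_iff.2 hne)]
    exact hij (i, j)
  · simp [hne]
  · exact (hA.sub_right ((Commute.one_right A).smul_right _)).smul_right _

/-- Being linked is a closed condition: the intermediate matrices may be taken in a compact set. -/
theorem isClosed_commutingChain [NormedField k] [ProperSpace k] [NeZero n] :
    IsClosed {p : Matrix (Fin n) (Fin n) k × Matrix (Fin n) (Fin n) k |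
      CommutingChain p.1 p.2} := by
  set K := normalizedMatrices k n 0
  have : CompactSpace K := isCompact_iff_compactSpace.1 (isCompact_normalizedMatrices 0)
  have hcl : IsClosed {z : (K × K) × (Matrix (Fin n) (Fin n) k × Matrix (Fin n) (Fin n) k) |
      (z.2.1 * z.1.1 = z.1.1 * z.2.1 ∧ (z.1.1 : Matrix (Fin n) (Fin n) k) * z.1.2 =
        z.1.2 * z.1.1) ∧ z.1.2 * z.2.2 = z.2.2 * z.1.2} :=
    ((isClosed_eq (by fun_prop) (by fun_prop)).inter
      (isClosed_eq (by fun_prop) (by fun_prop))).inter (isClosed_eq (by fun_prop) (by fun_prop))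
  convert isClosedMap_snd_of_compactSpace _ hcl
  ext ⟨A, B⟩
  constructor
  · rintro ⟨C, D, hC, hD, hAC, hCD, hDB⟩
    obtain ⟨C', hC', hC''⟩ := exists_normalized 0 hC
    obtain ⟨D', hD', hD''⟩ := exists_normalized 0 hD
    exact ⟨((⟨C', hC'⟩, ⟨D', hD'⟩), (A, B)),
      ⟨⟨hC'' _ hAC, hD'' _ (hC'' _ hCD.symm).symm⟩, (hD'' _ hDB.symm).symm⟩, rfl⟩
  · rintro ⟨⟨⟨C, D⟩, _⟩, ⟨⟨h1, h2⟩, h3⟩, rfl⟩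
    exact ⟨C, D, not_isScalarMatrix_of_mem_normalizedMatrices C.2,
      not_isScalarMatrix_of_mem_normalizedMatrices D.2, h1, h2, h3⟩

end chain

/-! ### Matrices with simple spectrum -/

section generic

open Matrix Polynomial

variable {K : Type*} [Field K] {n : ℕ}

/-- If `χ_A'(A)` is invertible then no eigenvalue of `A` is a double root of `χ_A`. -/
theorem Matrix.nodup_roots_charpoly (A : Matrix (Fin n) (Fin n) K)
    (hA : (aeval A A.charpoly.derivative).det ≠ 0) : A.charpoly.roots.Nodup := by
  classical
  have h0 : A.charpoly ≠ 0 := A.charpoly_monic.ne_zero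
  rw [Multiset.nodup_iff_count_le_one]
  intro x
  by_contra! hx
  rw [count_roots, one_lt_rootMultiplicity_iff_isRoot h0] at hx
  obtain ⟨v, hv0, hv⟩ := Matrix.exists_mulVec_eq_zero_iff.2
    ((Matrix.eval_charpoly A x).symm.trans hx.1)
  have hv' : Module.End.HasEigenvector (Matrix.toLin' A) x v := by
    refine Module.End.hasEigenvector_iff.2 ⟨Module.End.mem_eigenspace_iff.2 ?_, hv0⟩
    rw [Matrix.sub_mulVec] at hv
    simpa [Matrix.scalar_apply, ← Matrix.smul_one_eq_diagonal, Matrix.smul_mulVec,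
      sub_eq_zero, eq_comm] using hv
  have h1 := Module.End.aeval_apply_of_hasEigenvector (p := A.charpoly.derivative) hv'
  rw [hx.2.eq_zero, zero_smul] at h1
  refine hA (Matrix.exists_mulVec_eq_zero_iff.1 ⟨v, hv0, ?_⟩)
  have h2 : aeval (Matrix.toLin' A) A.charpoly.derivative =
      Matrix.toLin' (aeval A A.charpoly.derivative) :=
    aeval_algHom_apply (Matrix.toLinAlgEquiv' : Matrix (Fin n) (Fin n) K ≃ₐ[K] _).toAlgHom A _
  rw [← Matrix.toLin'_apply, ← h2, h1]

theorem Matrix.eq_diagonal_of_commute_diagonal {l : Fin n → K} (hl : Function.Injective l)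
    {C : Matrix (Fin n) (Fin n) K} (h : Commute (diagonal l) C) : C = diagonal (fun i => C i i) := by
  ext i j
  rcases eq_or_ne i j with rfl | hij
  · simp
  · have := congrFun (congrFun h i) j
    rw [diagonal_mul, mul_diagonal] at this
    rw [diagonal_apply_ne _ hij]
    by_contra h0
    exact hij (hl (mul_right_cancel₀ h0 (this.trans (mul_comm _ _))))

/-- A matrix with simple spectrum is diagonalizable, and the matrices commuting with it are
diagonal in the same basis. -/
theorem Matrix.exists_diagonalizing_centralizer [IsAlgClosed K] (A : Matrix (Fin n) (Fin n) K)
    (hA : (aeval A A.charpoly.derivative).det ≠ 0) :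
    ∃ V V' : Matrix (Fin n) (Fin n) K, V * V' = 1 ∧ V' * V = 1 ∧
      ∀ C, Commute A C → ∃ c, C = V * diagonal c * V' := by
  classical
  have hcard : A.charpoly.roots.toFinset.card = n := by
    rw [Multiset.toFinset_card_of_nodup (A.nodup_roots_charpoly hA),
      ← (IsAlgClosed.splits A.charpoly).natDegree_eq_card_roots, A.charpoly_natDegree_eq_dim,
      Fintype.card_fin]
  set e := A.charpoly.roots.toFinset.equivFinOfCardEq hcard
  set l : Fin n → K := fun i => e.symm i
  have hl : Function.Injective l := Subtype.val_injective.comp e.symm.injective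
  have hroot : ∀ i, ∃ v, v ≠ 0 ∧ (Matrix.scalar (Fin n) (l i) - A) *ᵥ v = 0 := fun i => by
    have h : l i ∈ A.charpoly.roots := Multiset.mem_toFinset.1 (e.symm i).2
    exact Matrix.exists_mulVec_eq_zero_iff.2
      ((Matrix.eval_charpoly A _).symm.trans (isRoot_of_mem_roots h))
  choose v hv0 hv using hroot
  have hAv : ∀ i, A *ᵥ v i = l i • v i := fun i => by
    have := hv i
    rw [Matrix.sub_mulVec] at this
    simpa [Matrix.scalar_apply, ← Matrix.smul_one_eq_diagonal, Matrix.smul_mulVec,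
      sub_eq_zero, eq_comm] using this
  have hli : LinearIndependent K v :=
    Module.End.eigenvectors_linearIndependent' (Matrix.toLin' A) l hl v fun i =>
      Module.End.hasEigenvector_iff.2
        ⟨Module.End.mem_eigenspace_iff.2 (by simpa using hAv i), hv0 i⟩
  set V : Matrix (Fin n) (Fin n) K := (Matrix.of v)ᵀ with hV
  have hVu : IsUnit V :=
    Matrix.linearIndependent_cols_iff_isUnit.1 (show LinearIndependent K V.col from hli)
  have hVd : IsUnit V.det := (Matrix.isUnit_iff_isUnit_det V).1 hVu
  have hAV : A * V = V * diagonal l := by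
    ext i j
    rw [mul_diagonal]
    have := congrFun (hAv j) i
    simpa [hV, Matrix.mul_apply, Matrix.mulVec, dotProduct, mul_comm] using this
  refine ⟨V, V⁻¹, Matrix.mul_nonsing_inv _ hVd, Matrix.nonsing_inv_mul _ hVd, fun C hC => ?_⟩
  have hcomm : Commute (diagonal l) (V⁻¹ * C * V) := by
    have h1 : diagonal l = V⁻¹ * A * V := by
      rw [Matrix.mul_assoc, hAV, ← Matrix.mul_assoc, Matrix.nonsing_inv_mul _ hVd, Matrix.one_mul]
    rw [h1]
    change V⁻¹ * A * V * (V⁻¹ * C * V) = V⁻¹ * C * V * (V⁻¹ * A * V)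
    simp only [Matrix.mul_assoc, Matrix.mul_nonsing_inv_cancel_left _ _ hVd]
    rw [← Matrix.mul_assoc A, hC.eq, Matrix.mul_assoc]
  refine ⟨fun i => (V⁻¹ * C * V) i i, ?_⟩
  rw [← Matrix.eq_diagonal_of_commute_diagonal hl hcomm]
  simp only [Matrix.mul_assoc, Matrix.mul_nonsing_inv_cancel_left _ _ hVd,
    Matrix.mul_nonsing_inv _ hVd, Matrix.mul_one]

theorem Matrix.map_det_aeval_derivative_charpoly {R S : Type*} [CommRing R] [CommRing S]
    (f : R →+* S) (M : Matrix (Fin n) (Fin n) R) :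
    f (aeval M M.charpoly.derivative).det =
      (aeval (M.map f) (M.map f).charpoly.derivative).det := by
  rw [RingHom.map_det, Matrix.charpoly_map, Polynomial.derivative_map]
  have h : f.mapMatrix.comp (algebraMap R (Matrix (Fin n) (Fin n) R)) =
      (algebraMap S (Matrix (Fin n) (Fin n) S)).comp f := by
    ext r i j
    simp [Matrix.algebraMap_matrix_apply, apply_ite f]
  rw [aeval_def, aeval_def, eval₂_map, hom_eval₂, h, RingHom.mapMatrix_apply]

/-- The polynomial `det χ_A'(A)` in the entries of `A`, which is the discriminant of `χ_A` up to sign,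
does not vanish identically. -/
theorem Matrix.det_aeval_derivative_charpoly_diagonal_ne_zero {l : Fin n → K}
    (hl : Function.Injective l) :
    (aeval (diagonal l) (diagonal l).charpoly.derivative).det ≠ 0 := by
  have h : aeval (diagonal l) (diagonal l).charpoly.derivative =
      diagonal fun i => (diagonal l).charpoly.derivative.eval (l i) := by
    have := aeval_algHom_apply (Matrix.diagonalAlgHom K : (Fin n → K) →ₐ[K] _) l
      (diagonal l).charpoly.derivative
    rw [Matrix.diagonalAlgHom_apply, Matrix.diagonalAlgHom_apply] at this
    rw [this]
    congr 1
    ext i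
    simp [Polynomial.coe_aeval_eq_eval]
  rw [h, det_diagonal, Finset.prod_ne_zero_iff]
  intro i _
  rw [charpoly_diagonal, Polynomial.derivative_prod_finset, Polynomial.eval_finsetSum,
    Finset.sum_eq_single i]
  · simp only [derivative_sub, derivative_X, derivative_C, sub_zero, mul_one, eval_prod, eval_sub,
      eval_X, eval_C, Finset.prod_ne_zero_iff, sub_ne_zero]
    exact fun j hj => hl.ne (Finset.ne_of_mem_erase hj).symm
  · intro j _ hj
    simp only [derivative_sub, derivative_X, derivative_C, sub_zero, mul_one, eval_prod]
    exact Finset.prod_eq_zero (Finset.mem_erase.2 ⟨hj.symm, Finset.mem_univ i⟩) (by simp)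
  · simp

/-- The key relation: if `diagonal d`, transported by `W`, commutes with `diagonal c`, then the
spectral projection of `diagonal c` for a value of `c`, transported back by `W`, has vanishing
entries wherever `d` takes different values. -/
theorem Matrix.adjugate_mul_indicator_mul_apply_eq_zero {W N : Matrix (Fin n) (Fin n) K}
    {c d : Fin n → K} (hW : W.det ≠ 0) (hN : W * diagonal d = N * W)
    (hc : Commute (diagonal c) N) (i : Fin n) {a b : Fin n} (hab : d a ≠ d b) [DecidableEq K] :
    (W.adjugate * diagonal (fun l => if c l = c i then (1 : K) else 0) * W) a b = 0 := by
  set e : Matrix (Fin n) (Fin n) K := diagonal (fun l => if c l = c i then (1 : K) else 0) with he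
  have hNe : e * N = N * e := by
    ext p q
    have hpq := congrFun (congrFun hc p) q
    rw [diagonal_mul, mul_diagonal] at hpq
    rw [he, diagonal_mul, mul_diagonal]
    by_cases h0 : N p q = 0
    · simp [h0]
    · rw [mul_right_cancel₀ h0 (hpq.trans (mul_comm _ _)), mul_comm]
  have hd : diagonal d * W.adjugate = W.adjugate * N := by
    have h1 : W.adjugate * (W * diagonal d) * W.adjugate = W.adjugate * (N * W) * W.adjugate := by
      rw [hN]
    simp only [← Matrix.mul_assoc, Matrix.adjugate_mul] at h1
    simp only [Matrix.mul_assoc, Matrix.mul_adjugate, Matrix.smul_mul, Matrix.one_mul,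
      Matrix.mul_smul, Matrix.mul_one] at h1
    exact smul_right_injective _ hW h1
  have hcomm : diagonal d * (W.adjugate * e * W) = W.adjugate * e * W * diagonal d := by
    rw [Matrix.mul_assoc _ W, hN, Matrix.mul_assoc _ e (N * W), ← Matrix.mul_assoc e N W, hNe,
      Matrix.mul_assoc N, ← Matrix.mul_assoc, ← Matrix.mul_assoc, hd]
    simp only [Matrix.mul_assoc]
  have h := congrFun (congrFun hcomm a) b
  rw [diagonal_mul, mul_diagonal] at h
  by_contra h0
  exact hab (mul_right_cancel₀ h0 (h.trans (mul_comm _ _)))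

/-- The relation of `Matrix.adjugate_mul_indicator_mul_apply_eq_zero` is not satisfied identically
in `W`. -/
theorem Matrix.exists_adjugate_mul_indicator_mul_apply_ne_zero (S : Fin n → Prop)
    [DecidablePred S] {i j : Fin n} (hi : S i) (hj : ¬ S j) {a b : Fin n} (hab : a ≠ b) :
    ∃ W : Matrix (Fin n) (Fin n) K,
      (W.adjugate * diagonal (fun l => if S l then (1 : K) else 0) * W) a b ≠ 0 := by
  have hij : i ≠ j := by rintro rfl; exact hj hi
  set σ : Equiv.Perm (Fin n) := Equiv.swap (Equiv.swap a i b) j * Equiv.swap a i with hσ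
  have hσa : σ a = i := by
    have h1 : i ≠ Equiv.swap a i b := fun h => hab (by
      have := (Equiv.swap a i).injective ((Equiv.swap_apply_left a i).trans h)
      exact this)
    simp [hσ, Equiv.swap_apply_of_ne_of_ne h1 hij]
  have hσb : σ b = j := by simp [hσ]
  -- The columns `a` and `b` of `W` are the basis vector `eᵢ` and `eᵢ + eⱼ`.
  set W : Matrix (Fin n) (Fin n) K := (transvection i j (1 : K)).submatrix id σ with hWdef
  have hdet : W.det ≠ 0 := by
    rw [hWdef, Matrix.det_permute', Matrix.det_transvection_of_ne _ _ hij]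
    rcases Int.units_eq_one_or (Equiv.Perm.sign σ) with h | h <;> simp [h]
  have hcol : ∀ r, (diagonal (fun l => if S l then (1 : K) else 0) * W) r b = W r a := by
    intro r
    rw [diagonal_mul]
    simp only [hWdef, submatrix_apply, id, hσa, hσb, transvection, add_apply, single_apply]
    rcases eq_or_ne r i with rfl | hri
    · simp [hi, hij, hij.symm]
    · rcases eq_or_ne r j with rfl | hrj
      · simp [hj, hij, hij.symm]
      · simp [hri, hrj, hri.symm]
  refine ⟨W, ?_⟩
  rw [Matrix.mul_assoc, Matrix.mul_apply]
  simp only [hcol]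
  rw [← Matrix.mul_apply, Matrix.adjugate_mul]
  simpa using hdet

end generic

/-! ### A random pair is not joined by a short chain -/

section null

open Matrix

theorem isScalarMatrix_of_map_eq_mul_diagonal_mul {k : Type*} [Field k] [Algebra k ℂ]
    {n : ℕ} [NeZero n] {C : Matrix (Fin n) (Fin n) k}
    {V V' : Matrix (Fin n) (Fin n) ℂ} (hV : V * V' = 1) {c : Fin n → ℂ}
    (hC : C.map (algebraMap k ℂ) = V * diagonal c * V') (hc : ∀ i j, c i = c j) :
    IsScalarMatrix C := by
  have h : C.map (algebraMap k ℂ) = c 0 • (1 : Matrix (Fin n) (Fin n) ℂ) := by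
    rw [hC, show c = fun _ => c 0 from funext fun i => hc i 0, ← Matrix.smul_one_eq_diagonal,
      Matrix.mul_smul, Matrix.smul_mul, Matrix.mul_one, hV]
  refine ⟨C 0 0, ?_⟩
  have h00 : algebraMap k ℂ (C 0 0) = c 0 := by simpa using congrFun (congrFun h 0) 0
  ext i j
  apply (algebraMap k ℂ).injective
  have hij := congrFun (congrFun h i) j
  rw [Matrix.map_apply] at hij
  rw [hij, ← h00]
  simp [Matrix.one_apply, apply_ite (algebraMap k ℂ)]

variable {k : Type*} [NontriviallyNormedField k] [ProperSpace k]
  [SecondCountableTopology k] [MeasureSpace k] [BorelSpace k]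
  [(volume : Measure k).IsAddHaarMeasure] [NullSingletonClass (volume : Measure k)]
  [NormedAlgebra k ℂ] {n : ℕ}

theorem Matrix.eval_mvPolynomialX_map (A : Matrix (Fin n) (Fin n) ℂ) :
    (mvPolynomialX (Fin n) (Fin n) ℂ).map (MvPolynomial.eval fun ij => A ij.1 ij.2) = A :=
  Matrix.mvPolynomialX_map_eval₂ (RingHom.id ℂ) A

/-- Almost every matrix has simple spectrum over `ℂ`. -/
theorem Matrix.ae_det_aeval_derivative_charpoly_ne_zero :
    ∀ᵐ A : Matrix (Fin n) (Fin n) k,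
      (Polynomial.aeval (A.map (algebraMap k ℂ))
        (A.map (algebraMap k ℂ)).charpoly.derivative).det ≠ 0 := by
  set p : MvPolynomial (Fin n × Fin n) ℂ := (Polynomial.aeval (mvPolynomialX (Fin n) (Fin n) ℂ)
        (mvPolynomialX (Fin n) (Fin n) ℂ).charpoly.derivative).det with hp
  have heval : ∀ A : Matrix (Fin n) (Fin n) ℂ, p.eval (fun ij => A ij.1 ij.2) =
      (Polynomial.aeval A A.charpoly.derivative).det := fun A => by
    rw [hp, Matrix.map_det_aeval_derivative_charpoly, Matrix.eval_mvPolynomialX_map]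
  have hp0 : p ≠ 0 := by
    intro h0
    refine Matrix.det_aeval_derivative_charpoly_diagonal_ne_zero
      (l := fun i : Fin n => ((i : ℕ) : ℂ)) (fun i j h => Fin.ext (Nat.cast_injective h)) ?_
    rw [← heval, h0, map_zero]
  filter_upwards [MvPolynomial.ae_eval_algebraMap_ne_zero (k := k) hp0] with A hA
  rw [← heval]
  exact hA

/-- If `A` and `B` have simple spectrum over `ℂ`, then almost no conjugate of `B` can be joined to
`A` by a chain with two non-scalar intermediate matrices. -/
theorem ae_not_commutingChain_conj [NeZero n] {A B : Matrix (Fin n) (Fin n) k}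
    (hA : (Polynomial.aeval (A.map (algebraMap k ℂ))
        (A.map (algebraMap k ℂ)).charpoly.derivative).det ≠ 0)
    (hB : (Polynomial.aeval (B.map (algebraMap k ℂ))
        (B.map (algebraMap k ℂ)).charpoly.derivative).det ≠ 0) :
    ∀ᵐ g : Matrix (Fin n) (Fin n) k, ¬ CommutingChain A (g * B * g.adjugate) := by
  classical
  obtain ⟨V, V', hVV', hV'V, hcA⟩ := Matrix.exists_diagonalizing_centralizer _ hA
  obtain ⟨U, U', hUU', hU'U, hcB⟩ := Matrix.exists_diagonalizing_centralizer _ hB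
  -- The matrix of `g` in the eigenbases of `A` and `B`.
  set Y : Matrix (Fin n) (Fin n) (MvPolynomial (Fin n × Fin n) ℂ) :=
    V'.map MvPolynomial.C * mvPolynomialX (Fin n) (Fin n) ℂ * U.map MvPolynomial.C with hY
  have hYeval : ∀ G : Matrix (Fin n) (Fin n) ℂ,
      Y.map (MvPolynomial.eval fun ij => G ij.1 ij.2) = V' * G * U := fun G => by
    rw [hY, Matrix.map_mul, Matrix.map_mul, Matrix.eval_mvPolynomialX_map]
    congr <;> ext <;> simp
  have hS : ∀ S : Finset (Fin n), ∀ i ∈ S, ∀ j ∉ S, ∀ a b : Fin n, a ≠ b →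
      ∀ᵐ g : Matrix (Fin n) (Fin n) k,
        ((V' * g.map (algebraMap k ℂ) * U).adjugate *
          diagonal (fun l => if l ∈ S then (1 : ℂ) else 0) *
            (V' * g.map (algebraMap k ℂ) * U)) a b ≠ 0 := by
    intro S i hi j hj a b hab
    set p : MvPolynomial (Fin n × Fin n) ℂ := (Y.adjugate *
      diagonal (fun l => if l ∈ S then (1 : MvPolynomial (Fin n × Fin n) ℂ) else 0) * Y) a b
      with hp
    have heval : ∀ G : Matrix (Fin n) (Fin n) ℂ, p.eval (fun ij => G ij.1 ij.2) =
        ((V' * G * U).adjugate * diagonal (fun l => if l ∈ S then (1 : ℂ) else 0) *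
          (V' * G * U)) a b := fun G => by
      rw [← hYeval, hp]
      set ev := MvPolynomial.eval fun ij : Fin n × Fin n => G ij.1 ij.2
      change (ev.mapMatrix (Y.adjugate *
        diagonal (fun l => if l ∈ S then (1 : MvPolynomial (Fin n × Fin n) ℂ) else 0) * Y)) a b = _
      rw [map_mul, map_mul, RingHom.map_adjugate]
      simp only [RingHom.mapMatrix_apply, Matrix.diagonal_map (map_zero ev), apply_ite ev,
        map_one, map_zero]
    have hp0 : p ≠ 0 := by
      intro h0
      obtain ⟨W, hW⟩ := Matrix.exists_adjugate_mul_indicator_mul_apply_ne_zero (K := ℂ)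
        (fun l => l ∈ S) hi hj hab
      have hVW : V' * (V * W * U') * U = W := by
        simp only [Matrix.mul_assoc, hU'U, Matrix.mul_one]
        rw [← Matrix.mul_assoc, hV'V, Matrix.one_mul]
      have := heval (V * W * U')
      rw [hVW, h0, map_zero] at this
      exact hW this.symm
    filter_upwards [MvPolynomial.ae_eval_algebraMap_ne_zero (k := k) hp0] with g hg
    rw [← heval]
    exact hg
  have hall : ∀ᵐ g : Matrix (Fin n) (Fin n) k, ∀ S : Finset (Fin n), ∀ i ∈ S, ∀ j ∉ S,
      ∀ a b : Fin n, a ≠ b → ((V' * g.map (algebraMap k ℂ) * U).adjugate *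
          diagonal (fun l => if l ∈ S then (1 : ℂ) else 0) *
            (V' * g.map (algebraMap k ℂ) * U)) a b ≠ 0 := by
    simp only [ae_all_iff]
    exact hS
  filter_upwards [hall, Matrix.ae_det_ne_zero] with g hg hdet
  rintro ⟨C, D, hC, hD, hAC, hCD, hDB⟩
  set φ := (algebraMap k ℂ).mapMatrix (m := Fin n) with hφ
  have hgadj : g * g.adjugate = g.det • 1 := Matrix.mul_adjugate g
  have hadjg : g.adjugate * g = g.det • 1 := Matrix.adjugate_mul g
  have hBD : Commute B (g.adjugate * D * g) := by
    have h1 : g.adjugate * (D * (g * B * g.adjugate)) * g =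
        g.adjugate * ((g * B * g.adjugate) * D) * g := by rw [hDB.eq]
    have h2 : g.adjugate * D * g * B * (g.adjugate * g) =
        (g.adjugate * g) * B * (g.adjugate * D * g) := by
      simpa only [Matrix.mul_assoc] using h1
    rw [hadjg, Matrix.mul_smul, Matrix.smul_mul, Matrix.smul_mul, Matrix.mul_one,
      Matrix.one_mul] at h2
    exact (smul_right_injective _ hdet h2).symm
  obtain ⟨c, hc⟩ := hcA _ (hAC.map φ)
  obtain ⟨d, hd⟩ := hcB _ (hBD.map φ)
  obtain ⟨i, j, hij⟩ : ∃ i j, c i ≠ c j := by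
    by_contra! h
    exact hC (isScalarMatrix_of_map_eq_mul_diagonal_mul hVV' hc h)
  obtain ⟨a, b, hab⟩ : ∃ a b, d a ≠ d b := by
    by_contra! h
    obtain ⟨x, hx⟩ := isScalarMatrix_of_map_eq_mul_diagonal_mul hUU' hd h
    refine hD ⟨g.det⁻¹ * x, ?_⟩
    have h1 : g * (g.adjugate * D * g) * g.adjugate = (g.det * g.det) • D := by
      simp only [Matrix.mul_assoc, hgadj]
      rw [← Matrix.mul_assoc, hgadj]
      simp [smul_smul]
    rw [hx, Matrix.mul_smul, Matrix.mul_one, Matrix.smul_mul, hgadj, smul_smul] at h1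
    have h2 := congrArg (fun M => (g.det * g.det)⁻¹ • M) h1
    simp only [smul_smul, inv_mul_cancel₀ (mul_ne_zero hdet hdet), one_smul] at h2
    rw [← h2]
    congr 1
    field_simp
  set G := g.map (algebraMap k ℂ) with hG
  have hGφ : φ g = G := rfl
  have hGdet : G.det ≠ 0 := by
    rw [← hGφ, hφ, ← RingHom.map_det]
    simpa using hdet
  set W := V' * G * U with hW
  have hWdet : W.det ≠ 0 := by
    rw [hW, det_mul, det_mul]
    exact mul_ne_zero (mul_ne_zero (Matrix.isUnit_det_of_right_inverse hV'V).ne_zero hGdet)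
      (Matrix.isUnit_det_of_left_inverse hU'U).ne_zero
  set N : Matrix (Fin n) (Fin n) ℂ := G.det • (V' * φ D * V) with hN
  have hWN : W * diagonal d = N * W := by
    have h1 : U * diagonal d = φ (g.adjugate * D * g) * U := by
      have h : φ (g.adjugate * D * g) = U * diagonal d * U' := hd
      rw [h, Matrix.mul_assoc _ U', hU'U, Matrix.mul_one]
    have h2 : G * φ (g.adjugate * D * g) = G.det • (φ D * G) := by
      rw [← hGφ, hφ, ← RingHom.map_det, ← hφ, ← map_mul, ← map_mul, Matrix.mul_assoc,
        ← Matrix.mul_assoc g, hgadj]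
      simp [hφ, Matrix.map_smul']
    rw [hW, Matrix.mul_assoc _ U, h1, Matrix.mul_assoc V', ← Matrix.mul_assoc G, h2, hN]
    simp only [Matrix.mul_assoc, Matrix.mul_smul, Matrix.smul_mul]
    rw [← Matrix.mul_assoc V, hVV', Matrix.one_mul]
  have hcN : Commute (diagonal c) N := by
    have hc' : φ C = V * diagonal c * V' := hc
    have h1 : diagonal c = V' * φ C * V := by
      rw [hc']
      simp only [Matrix.mul_assoc, hV'V, Matrix.mul_one]
      rw [← Matrix.mul_assoc, hV'V, Matrix.one_mul]
    have h2 : ∀ X Z : Matrix (Fin n) (Fin n) ℂ,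
        V' * X * V * (V' * Z * V) = V' * (X * Z) * V := fun X Z => by
      simp only [Matrix.mul_assoc]
      rw [← Matrix.mul_assoc V, hVV', Matrix.one_mul]
    rw [h1]
    refine Commute.smul_right ?_ _
    rw [commute_iff_eq, h2, h2, (hCD.map φ).eq]
  have h0 := Matrix.adjugate_mul_indicator_mul_apply_eq_zero hWdet hWN hcN i hab
  refine hg (Finset.univ.filter fun l => c l = c i) i (by simp) j (by simpa using hij.symm) a b
    (fun h => hab (congrArg d h)) ?_
  simpa using h0

/-- Almost no pair of matrices is joined by a commuting chain with two non-scalar intermediate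
matrices. -/
theorem ae_not_commutingChain [NeZero n] :
    ∀ᵐ p : Matrix (Fin n) (Fin n) k × Matrix (Fin n) (Fin n) k, ¬ CommutingChain p.1 p.2 := by
  refine Matrix.ae_mem_of_ae_conj_mem (isClosed_commutingChain.measurableSet.compl) ?_
  have h := Matrix.ae_det_aeval_derivative_charpoly_ne_zero (k := k) (n := n)
  filter_upwards [Measure.quasiMeasurePreserving_fst.ae h,
    Measure.quasiMeasurePreserving_snd.ae h] with p h1 h2
  exact ae_not_commutingChain_conj h1 h2

end null

/-! ### Long chains through matrices of small rank -/

section algebra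

open Matrix

variable {K : Type*} [Field K] {n : ℕ}

theorem not_isScalarMatrix_of_mul_eq_zero {P C : Matrix (Fin n) (Fin n) K} (hP : P ≠ 0)
    (hC : C ≠ 0) (h : P * C = 0) : ¬ IsScalarMatrix P := by
  rintro ⟨c, rfl⟩
  rw [Matrix.smul_mul, Matrix.one_mul, smul_eq_zero] at h
  rcases h with rfl | h
  · exact hP (zero_smul _ _)
  · exact hC h

theorem IsScalarMatrix.transpose {C : Matrix (Fin n) (Fin n) K} (h : IsScalarMatrix C) :
    IsScalarMatrix Cᵀ := by
  obtain ⟨c, rfl⟩ := h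
  exact ⟨c, by simp⟩

variable {p q : Type*} [Fintype p] [Fintype q]

theorem Matrix.exists_mulVec_eq_zero_of_card_lt (M : Matrix p (Fin n) K)
    (h : Fintype.card p < n) : ∃ x, x ≠ 0 ∧ M *ᵥ x = 0 := by
  have hker : LinearMap.ker M.mulVecLin ≠ ⊥ :=
    LinearMap.ker_ne_bot_of_finrank_lt (by simpa using h)
  obtain ⟨x, hx, hx0⟩ := (Submodule.ne_bot_iff _).1 hker
  exact ⟨x, hx0, hx⟩

/-- If two matrices have a common kernel vector `x` and a common left kernel vector `y`, then both
are annihilated from both sides by the rank one matrix `x yᵀ`. -/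
theorem exists_nonscalar_commute_of_common_kernel {G : Matrix (Fin n) p K}
    {H : Matrix p (Fin n) K} {G' : Matrix (Fin n) q K} {H' : Matrix q (Fin n) K}
    (hGH : G * H ≠ 0) {x y : Fin n → K} (hx : x ≠ 0) (hHx : fromRows H H' *ᵥ x = 0)
    (hy : y ≠ 0) (hyG : y ᵥ* fromCols G G' = 0) :
    ∃ C : Matrix (Fin n) (Fin n) K, ¬ IsScalarMatrix C ∧ Commute (G * H) C ∧
      Commute C (G' * H') := by
  rw [fromRows_mulVec] at hHx
  rw [vecMul_fromCols] at hyG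
  have hx1 : H *ᵥ x = 0 := funext fun i => congrFun hHx (Sum.inl i)
  have hx2 : H' *ᵥ x = 0 := funext fun i => congrFun hHx (Sum.inr i)
  have hy1 : y ᵥ* G = 0 := funext fun i => congrFun hyG (Sum.inl i)
  have hy2 : y ᵥ* G' = 0 := funext fun i => congrFun hyG (Sum.inr i)
  have h1 : G * H * vecMulVec x y = 0 := by
    rw [mul_vecMulVec, ← mulVec_mulVec, hx1, mulVec_zero, zero_vecMulVec]
  have h2 : G' * H' * vecMulVec x y = 0 := by
    rw [mul_vecMulVec, ← mulVec_mulVec, hx2, mulVec_zero, zero_vecMulVec]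
  have h3 : vecMulVec x y * (G * H) = 0 := by
    rw [vecMulVec_mul, ← vecMul_vecMul, hy1, zero_vecMul, vecMulVec_zero]
  have h4 : vecMulVec x y * (G' * H') = 0 := by
    rw [vecMulVec_mul, ← vecMul_vecMul, hy2, zero_vecMul, vecMulVec_zero]
  exact ⟨vecMulVec x y, not_isScalarMatrix_of_mul_eq_zero (vecMulVec_ne_zero hx hy) hGH h3,
    h1.trans h3.symm, h4.trans h2.symm⟩

/-- Two factored matrices whose inner dimensions add up to less than `n` have a common kernel vector
and a common left kernel vector. -/
theorem exists_nonscalar_commute_of_card_lt {G : Matrix (Fin n) p K}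
    {H : Matrix p (Fin n) K} {G' : Matrix (Fin n) q K} {H' : Matrix q (Fin n) K}
    (hGH : G * H ≠ 0) (hn : Fintype.card p + Fintype.card q < n) :
    ∃ C : Matrix (Fin n) (Fin n) K, ¬ IsScalarMatrix C ∧ Commute (G * H) C ∧
      Commute C (G' * H') := by
  rw [← Fintype.card_sum] at hn
  obtain ⟨x, hx, hHx⟩ := (fromRows H H').exists_mulVec_eq_zero_of_card_lt hn
  obtain ⟨y, hy, hyG⟩ := (fromCols G G')ᵀ.exists_mulVec_eq_zero_of_card_lt hn
  rw [mulVec_transpose] at hyG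
  exact exists_nonscalar_commute_of_common_kernel hGH hx hHx hy hyG

/-- If `X` is invertible and `X Y` is a scalar, then conjugation by `X` extends any `E` to an
endomorphism of the pair `(X, Y)`. -/
theorem Matrix.exists_conj_pair_of_isUnit_det {X Y : Matrix (Fin 2) (Fin 2) K}
    (hX : IsUnit X.det) {γ : K} (h : X * Y = γ • 1) :
    ∃ E F : Matrix (Fin 2) (Fin 2) K, E * X = X * F ∧ F * Y = Y * E ∧
      ¬ ∃ c : K, E = c • 1 ∧ F = c • 1 := by
  have hY : Y = γ • X⁻¹ := by
    rw [← Matrix.one_mul Y, ← nonsing_inv_mul X hX, Matrix.mul_assoc, h, Matrix.mul_smul,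
      Matrix.mul_one]
  refine ⟨single 0 1 1, X⁻¹ * single 0 1 1 * X, ?_, ?_, ?_⟩
  · rw [← Matrix.mul_assoc, ← Matrix.mul_assoc, mul_nonsing_inv _ hX, Matrix.one_mul]
  · rw [hY, Matrix.mul_smul, Matrix.mul_assoc, mul_nonsing_inv _ hX, Matrix.mul_one,
      Matrix.smul_mul]
  · rintro ⟨c, hc, -⟩
    have := congrFun (congrFun hc 0) 1
    simp at this

/-- A pair of `2 × 2` matrices, seen as maps `X : K² → K²` and `Y : K² → K²` in opposite directions
between two planes, has an endomorphism `(E, F)` that is not a scalar. -/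
theorem Matrix.exists_nonscalar_endomorphism_pair (X Y : Matrix (Fin 2) (Fin 2) K) :
    ∃ E F : Matrix (Fin 2) (Fin 2) K, E * X = X * F ∧ F * Y = Y * E ∧
      ¬ ∃ c : K, E = c • 1 ∧ F = c • 1 := by
  by_cases h1 : ∃ γ : K, X * Y = γ • 1
  swap
  · exact ⟨X * Y, Y * X, Matrix.mul_assoc _ _ _, Matrix.mul_assoc _ _ _,
      fun ⟨c, hc, _⟩ => h1 ⟨c, hc⟩⟩
  by_cases h2 : ∃ γ : K, Y * X = γ • 1
  swap
  · exact ⟨X * Y, Y * X, Matrix.mul_assoc _ _ _, Matrix.mul_assoc _ _ _,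
      fun ⟨c, _, hc⟩ => h2 ⟨c, hc⟩⟩
  obtain ⟨γ, h1⟩ := h1
  obtain ⟨γ', h2⟩ := h2
  by_cases hX : X.det = 0
  swap
  · exact Matrix.exists_conj_pair_of_isUnit_det (isUnit_iff_ne_zero.2 hX) h1
  by_cases hY : Y.det = 0
  swap
  · obtain ⟨F, E, hF, hE, hne⟩ :=
      Matrix.exists_conj_pair_of_isUnit_det (isUnit_iff_ne_zero.2 hY) h2
    exact ⟨E, F, hE, hF, fun ⟨c, hc, hc'⟩ => hne ⟨c, hc', hc⟩⟩
  obtain ⟨y, hy0, hy⟩ := exists_vecMul_eq_zero_iff.2 hX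
  obtain ⟨x, hx0, hx⟩ := exists_mulVec_eq_zero_iff.2 hY
  refine ⟨vecMulVec x y, 0, ?_, ?_, ?_⟩
  · rw [vecMulVec_mul, hy, vecMulVec_zero, Matrix.mul_zero]
  · rw [mul_vecMulVec, hx, zero_vecMulVec, Matrix.zero_mul]
  · rintro ⟨c, hE, hF⟩
    have hc : c = 0 := by simpa using congrFun (congrFun hF.symm 0) 0
    exact vecMulVec_ne_zero hx0 hy0 (by rw [hE, hc, zero_smul])

/-- If the column spaces of `G` and `G'` are complementary, then in the decomposition they define
the matrices `G H` and `G' H'` have block rows `(a, H G')`, `(0, 0)` and `(0, 0)`, `(H' G, b)`, and an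
endomorphism of the pair `(H G', H' G)` commutes with both. -/
theorem exists_nonscalar_commute_of_isCompl {G G' : Matrix (Fin n) (Fin 2) K}
    {H H' L L' : Matrix (Fin 2) (Fin n) K} {a b : K}
    (hHG : H * G = a • 1) (hHG' : H' * G' = b • 1)
    (h11 : L * G = 1) (h12 : L * G' = 0) (h21 : L' * G = 0) (h22 : L' * G' = 1)
    (hsum : G * L + G' * L' = 1) :
    ∃ C : Matrix (Fin n) (Fin n) K, ¬ IsScalarMatrix C ∧ Commute (G * H) C ∧
      Commute C (G' * H') := by
  obtain ⟨E, F, hE, hF, hne⟩ := Matrix.exists_nonscalar_endomorphism_pair (H * G') (H' * G)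
  have hCG : (G * E * L + G' * F * L') * G = G * E := by
    rw [Matrix.add_mul, Matrix.mul_assoc _ L, Matrix.mul_assoc _ L', h11, h21]; simp
  have hCG' : (G * E * L + G' * F * L') * G' = G' * F := by
    rw [Matrix.add_mul, Matrix.mul_assoc _ L, Matrix.mul_assoc _ L', h12, h22]; simp
  have hHC : H * (G * E * L + G' * F * L') = E * H := by
    have h : H * (G * E * L + G' * F * L') = (H * G) * E * L + (H * G' * F) * L' := by
      simp only [Matrix.mul_add, Matrix.mul_assoc]
    rw [h, ← hE, hHG]
    conv_rhs => rw [← Matrix.mul_one (E * H), ← hsum, Matrix.mul_add, ← Matrix.mul_assoc,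
      Matrix.mul_assoc E H G, hHG]
    simp [Matrix.mul_assoc]
  have hHC' : H' * (G * E * L + G' * F * L') = F * H' := by
    have h : H' * (G * E * L + G' * F * L') = (H' * G * E) * L + (H' * G') * F * L' := by
      simp only [Matrix.mul_add, Matrix.mul_assoc]
    rw [h, ← hF, hHG']
    conv_rhs => rw [← Matrix.mul_one (F * H'), ← hsum, Matrix.mul_add,
      ← Matrix.mul_assoc (F * H') G', Matrix.mul_assoc F H' G', hHG']
    simp [Matrix.mul_assoc]
  refine ⟨G * E * L + G' * F * L', ?_, ?_, ?_⟩
  · rintro ⟨c, hc⟩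
    refine hne ⟨c, ?_, ?_⟩
    · rw [← Matrix.one_mul E, ← h11, Matrix.mul_assoc, ← hCG, hc]; simp [h11]
    · rw [← Matrix.one_mul F, ← h22, Matrix.mul_assoc, ← hCG', hc]; simp [h22]
  · rw [commute_iff_eq, Matrix.mul_assoc, hHC, ← Matrix.mul_assoc _ G, hCG, Matrix.mul_assoc]
  · rw [commute_iff_eq, ← Matrix.mul_assoc, hCG', Matrix.mul_assoc G' F, ← hHC', ← Matrix.mul_assoc]

theorem exists_nonscalar_commute_of_vecMul_ne_zero {G G' : Matrix (Fin 4) (Fin 2) K}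
    {H H' : Matrix (Fin 2) (Fin 4) K} {a b : K}
    (hHG : H * G = a • 1) (hHG' : H' * G' = b • 1)
    (h : ∀ y, y ᵥ* fromCols G G' = 0 → y = 0) :
    ∃ C : Matrix (Fin 4) (Fin 4) K, ¬ IsScalarMatrix C ∧ Commute (G * H) C ∧
      Commute C (G' * H') := by
  set e : Fin 4 ≃ Fin 2 ⊕ Fin 2 := (finSumFinEquiv (m := 2) (n := 2)).symm
  set S := (fromCols G G').submatrix id e with hS
  have hdet : IsUnit S.det := by
    rw [isUnit_iff_ne_zero]
    intro h0
    obtain ⟨y, hy0, hy⟩ := exists_vecMul_eq_zero_iff.2 h0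
    refine hy0 (h y (funext fun i => ?_))
    simpa [hS, vecMul, dotProduct] using congrFun hy (e.symm i)
  set T := S⁻¹.submatrix e.symm id with hT
  have hTS : T * fromCols G G' = 1 := by
    have h1 : fromCols G G' = S.submatrix id e.symm := by ext; simp [hS]
    rw [h1, hT, ← submatrix_mul _ _ _ _ _ Function.bijective_id, nonsing_inv_mul _ hdet,
      submatrix_one_equiv]
  have hST : fromCols G G' * T = 1 := by
    have h1 : fromCols G G' = S.submatrix id e.symm := by ext; simp [hS]
    rw [h1, hT, ← submatrix_mul _ _ _ _ _ e.symm.bijective, mul_nonsing_inv _ hdet, submatrix_id_id]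
  rw [← fromRows_toRows T, fromRows_mul_fromCols, ← fromBlocks_one, fromBlocks_inj] at hTS
  rw [← fromRows_toRows T, fromCols_mul_fromRows] at hST
  exact exists_nonscalar_commute_of_isCompl hHG hHG' hTS.1 hTS.2.1 hTS.2.2.1 hTS.2.2.2 hST

/-- In dimension four, two matrices of rank at most two, each acting as a scalar on a plane
containing its image, both commute with some non-scalar matrix. -/
theorem exists_nonscalar_commute_four {G G' : Matrix (Fin 4) (Fin 2) K}
    {H H' : Matrix (Fin 2) (Fin 4) K} {a b : K} (hGH : G * H ≠ 0)
    (hHG : H * G = a • 1) (hHG' : H' * G' = b • 1) :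
    ∃ C : Matrix (Fin 4) (Fin 4) K, ¬ IsScalarMatrix C ∧ Commute (G * H) C ∧
      Commute C (G' * H') := by
  by_cases hy : ∀ y, y ᵥ* fromCols G G' = 0 → y = 0
  · exact exists_nonscalar_commute_of_vecMul_ne_zero hHG hHG' hy
  by_cases hx : ∀ x, fromRows H H' *ᵥ x = 0 → x = 0
  · -- The transposed matrices satisfy the hypothesis of the first case.
    obtain ⟨C, hC, h1, h2⟩ := exists_nonscalar_commute_of_vecMul_ne_zero (G := Hᵀ) (G' := H'ᵀ)
      (H := Gᵀ) (H' := G'ᵀ) (a := a) (b := b)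
      (by rw [← transpose_mul, hHG]; simp) (by rw [← transpose_mul, hHG']; simp)
      (fun y h => hx y (by rwa [← transpose_fromRows, vecMul_transpose] at h))
    refine ⟨Cᵀ, fun h => hC (by simpa using h.transpose), ?_, ?_⟩
    · have := congrArg Matrix.transpose h1.eq
      simp only [transpose_mul, transpose_transpose] at this
      simpa only [commute_iff_eq, transpose_mul] using this.symm
    · have := congrArg Matrix.transpose h2.eq
      simp only [transpose_mul, transpose_transpose] at this
      simpa only [commute_iff_eq, transpose_mul] using this.symm
  push Not at hx hy
  obtain ⟨x, hx, hx0⟩ := hx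
  obtain ⟨y, hy, hy0⟩ := hy
  exact exists_nonscalar_commute_of_common_kernel hGH hx0 hx hy0 hy

/-- The product of a right and a left eigenvector for the same eigenvalue of `A` is a rank one
matrix commuting with `A`. -/
theorem Matrix.exists_rank_one_commute {A : Matrix (Fin n) (Fin n) K} {x : K}
    (hx : A.charpoly.IsRoot x) :
    ∃ (G : Matrix (Fin n) (Fin 1) K) (H : Matrix (Fin 1) (Fin n) K),
      G * H ≠ 0 ∧ Commute A (G * H) := by
  have hdet : (scalar (Fin n) x - A).det = 0 := (eval_charpoly A x).symm.trans hx
  obtain ⟨v, hv0, hv⟩ := exists_mulVec_eq_zero_iff.2 hdet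
  obtain ⟨w, hw0, hw⟩ := exists_vecMul_eq_zero_iff.2 hdet
  have hprod : replicateCol (Fin 1) v * replicateRow (Fin 1) w = vecMulVec v w :=
    (vecMulVec_eq (Fin 1) v w).symm
  refine ⟨replicateCol (Fin 1) v, replicateRow (Fin 1) w, ?_, ?_⟩
  · rw [hprod]
    exact vecMulVec_ne_zero hv0 hw0
  · rw [hprod]
    have h1 : (scalar (Fin n) x - A) * vecMulVec v w = vecMulVec v w * (scalar (Fin n) x - A) := by
      rw [mul_vecMulVec, vecMulVec_mul, hv, hw, zero_vecMulVec, vecMulVec_zero]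
    have h2 : Commute (scalar (Fin n) x) (vecMulVec v w) := scalar_commute x (Commute.all x) _
    rw [Matrix.sub_mul, Matrix.mul_sub, h2.eq] at h1
    exact sub_right_injective h1

theorem not_isScalarMatrix_mul_of_card_lt {G : Matrix (Fin n) p K} {H : Matrix p (Fin n) K}
    (hGH : G * H ≠ 0) (h : Fintype.card p < n) : ¬ IsScalarMatrix (G * H) := by
  obtain ⟨x, hx0, hx⟩ := H.exists_mulVec_eq_zero_of_card_lt h
  refine not_isScalarMatrix_of_mul_eq_zero hGH (vecMulVec_ne_zero hx0 hx0) ?_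
  rw [mul_vecMulVec, ← mulVec_mulVec, hx, mulVec_zero, zero_vecMulVec]

/-- `A` and `B` can be joined by a chain of consecutively commuting matrices with three non-scalar
intermediate terms. -/
def LongCommutingChain (A B : Matrix (Fin n) (Fin n) K) : Prop :=
  ∃ P C Q : Matrix (Fin n) (Fin n) K, ¬ IsScalarMatrix P ∧ ¬ IsScalarMatrix C ∧
    ¬ IsScalarMatrix Q ∧ Commute A P ∧ Commute P C ∧ Commute C Q ∧ Commute Q B

theorem longCommutingChain_of_factors {A B : Matrix (Fin n) (Fin n) K}
    {G : Matrix (Fin n) p K} {H : Matrix p (Fin n) K} {G' : Matrix (Fin n) q K}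
    {H' : Matrix q (Fin n) K} (hp : Fintype.card p < n) (hq : Fintype.card q < n)
    (hGH : G * H ≠ 0) (hGH' : G' * H' ≠ 0) (hA : Commute A (G * H)) (hB : Commute B (G' * H'))
    (hC : ∃ C : Matrix (Fin n) (Fin n) K, ¬ IsScalarMatrix C ∧ Commute (G * H) C ∧
      Commute C (G' * H')) : LongCommutingChain A B := by
  obtain ⟨C, hC, h1, h2⟩ := hC
  exact ⟨G * H, C, G' * H', not_isScalarMatrix_mul_of_card_lt hGH hp, hC,
    not_isScalarMatrix_mul_of_card_lt hGH' hq, hA, h1, h2, hB.symm⟩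

theorem longCommutingChain_of_isAlgClosed [IsAlgClosed K] (hn : 3 ≤ n)
    (A B : Matrix (Fin n) (Fin n) K) : LongCommutingChain A B := by
  have hroot : ∀ M : Matrix (Fin n) (Fin n) K, ∃ x, M.charpoly.IsRoot x := fun M =>
    IsAlgClosed.exists_root M.charpoly (by
      rw [charpoly_degree_eq_dim, Fintype.card_fin]
      exact_mod_cast (by omega : n ≠ 0))
  obtain ⟨x, hx⟩ := hroot A
  obtain ⟨y, hy⟩ := hroot B
  obtain ⟨G, H, hGH, hA⟩ := Matrix.exists_rank_one_commute hx
  obtain ⟨G', H', hGH', hB⟩ := Matrix.exists_rank_one_commute hy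
  exact longCommutingChain_of_factors (by simp; omega) (by simp; omega) hGH hGH' hA hB
    (exists_nonscalar_commute_of_card_lt hGH (by simp; omega))

end algebra

/-! ### Long chains over the real numbers -/

section real

open Matrix

variable {n : ℕ}

/-- The real part of `v wᵀ`, for right and left eigenvectors `v`, `w` of a real matrix `A` with the
same eigenvalue, commutes with `A`. It factors through the plane spanned by the real and imaginary
parts of `v`, on which it is a scalar as soon as `w ⬝ v` is real and `w ⬝ v̄ = 0`. -/
theorem Matrix.exists_rank_two_commute_of_eigenvectors {A : Matrix (Fin n) (Fin n) ℝ} {x : ℂ}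
    {v w : Fin n → ℂ} (hv : A.map Complex.ofReal *ᵥ v = x • v)
    (hw : w ᵥ* A.map Complex.ofReal = x • w) (hre : (w ⬝ᵥ v).im = 0)
    (hconj : w ⬝ᵥ star v = 0) (hne : ∃ i j, (v i * w j).re ≠ 0) :
    ∃ (G : Matrix (Fin n) (Fin 2) ℝ) (H : Matrix (Fin 2) (Fin n) ℝ) (a : ℝ),
      G * H ≠ 0 ∧ H * G = a • 1 ∧ Commute A (G * H) := by
  set G : Matrix (Fin n) (Fin 2) ℝ := of fun i => ![(v i).re, (v i).im] with hG
  set H : Matrix (Fin 2) (Fin n) ℝ := of ![fun j => (w j).re, fun j => -(w j).im] with hH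
  have hGH : ∀ i j, (G * H) i j = (v i * w j).re := fun i j => by
    simp [hG, hH, Matrix.mul_apply, Fin.sum_univ_two, Complex.mul_re, sub_eq_add_neg]
  refine ⟨G, H, (w ⬝ᵥ v).re / 2, ?_, ?_, ?_⟩
  · obtain ⟨i, j, hij⟩ := hne
    intro h0
    exact hij (by rw [← hGH, h0, Matrix.zero_apply])
  · have e1 : (w ⬝ᵥ v).re = ∑ i, (w i).re * (v i).re - ∑ i, (w i).im * (v i).im := by
      simp [dotProduct, Complex.mul_re, Finset.sum_sub_distrib]
    have e2 : ∑ i, (w i).re * (v i).im + ∑ i, (w i).im * (v i).re = 0 := by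
      rw [← hre]; simp [dotProduct, Complex.mul_im, Finset.sum_add_distrib]
    have e3 : ∑ i, (w i).re * (v i).re + ∑ i, (w i).im * (v i).im = 0 := by
      have := congrArg Complex.re hconj
      simpa [dotProduct, Complex.mul_re, Finset.sum_add_distrib] using this
    have e4 : -∑ i, (w i).re * (v i).im + ∑ i, (w i).im * (v i).re = 0 := by
      have := congrArg Complex.im hconj
      simpa [dotProduct, Complex.mul_im, Finset.sum_add_distrib] using this
    ext i j
    fin_cases i <;> fin_cases j <;>
      simp [hG, hH, Matrix.mul_apply, -Complex.re_sum, -Complex.im_sum] <;> linarith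
  · ext i j
    rw [Matrix.mul_apply, Matrix.mul_apply]
    simp only [hGH]
    have h1 := congrFun hv i
    have h2 := congrFun hw j
    simp only [mulVec, vecMul, dotProduct, Matrix.map_apply, Pi.smul_apply, smul_eq_mul] at h1 h2
    calc ∑ l, A i l * (v l * w j).re = ((∑ l, (A i l : ℂ) * v l) * w j).re := by
          rw [Finset.sum_mul, Complex.re_sum]
          exact Finset.sum_congr rfl fun l _ => by rw [mul_assoc, Complex.re_ofReal_mul]
      _ = (v i * (∑ l, w l * (A l j : ℂ))).re := by rw [h1, h2]; congr 1; ring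
      _ = ∑ l, (v i * w l).re * A l j := by
          rw [Finset.mul_sum, Complex.re_sum]
          exact Finset.sum_congr rfl fun l _ => by rw [← mul_assoc, Complex.re_mul_ofReal]

/-- The real part of `v wᵀ` may vanish, or `w ⬝ v` may fail to be real; both are repaired by a complex
scaling of `v`. -/
theorem Matrix.exists_rank_two_commute {A : Matrix (Fin n) (Fin n) ℝ} {x : ℂ}
    (hx : (A.map Complex.ofReal).charpoly.IsRoot x) (him : x.im ≠ 0) :
    ∃ (G : Matrix (Fin n) (Fin 2) ℝ) (H : Matrix (Fin 2) (Fin n) ℝ) (a : ℝ),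
      G * H ≠ 0 ∧ H * G = a • 1 ∧ Commute A (G * H) := by
  have hdet : (scalar (Fin n) x - A.map Complex.ofReal).det = 0 := (eval_charpoly _ x).symm.trans hx
  obtain ⟨v, hv0, hv⟩ := exists_mulVec_eq_zero_iff.2 hdet
  obtain ⟨w, hw0, hw⟩ := exists_vecMul_eq_zero_iff.2 hdet
  replace hv : A.map Complex.ofReal *ᵥ v = x • v := by
    rw [sub_mulVec] at hv
    simpa [scalar_apply, ← smul_one_eq_diagonal, smul_mulVec, sub_eq_zero, eq_comm] using hv
  replace hw : w ᵥ* A.map Complex.ofReal = x • w := by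
    rw [vecMul_sub] at hw
    simpa [scalar_apply, ← smul_one_eq_diagonal, vecMul_smul, sub_eq_zero, eq_comm] using hw
  -- `w` and `star v` belong to the distinct eigenvalues `x` and `star x`.
  have hconj : w ⬝ᵥ star v = 0 := by
    have h1 : A.map Complex.ofReal *ᵥ star v = star x • star v := by
      rw [← star_smul, ← hv]
      ext i
      simp [mulVec, dotProduct]
    have h2 : w ⬝ᵥ (A.map Complex.ofReal *ᵥ star v) = (w ᵥ* A.map Complex.ofReal) ⬝ᵥ star v :=
      dotProduct_mulVec _ _ _
    rw [h1, hw, dotProduct_smul, smul_dotProduct, smul_eq_mul, smul_eq_mul] at h2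
    by_contra h0
    have h3 : star x = x := mul_right_cancel₀ h0 h2
    exact him (Complex.conj_eq_iff_im.1 h3)
  have key : ∀ ζ : ℂ, (w ⬝ᵥ (ζ • v)).im = 0 → (∃ i j, ((ζ • v) i * w j).re ≠ 0) →
      ∃ (G : Matrix (Fin n) (Fin 2) ℝ) (H : Matrix (Fin 2) (Fin n) ℝ) (a : ℝ),
        G * H ≠ 0 ∧ H * G = a • 1 ∧ Commute A (G * H) := fun ζ h1 h2 =>
    Matrix.exists_rank_two_commute_of_eigenvectors (x := x)
      (by rw [mulVec_smul, hv, smul_comm]) hw h1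
      (by rw [star_smul, dotProduct_smul, hconj, smul_zero]) h2
  by_cases hs : w ⬝ᵥ v = 0
  · have him0 : ∀ ζ : ℂ, (w ⬝ᵥ (ζ • v)).im = 0 := fun ζ => by simp [hs]
    by_cases h1 : ∃ i j, (((1 : ℂ) • v) i * w j).re ≠ 0
    · exact key 1 (him0 1) h1
    by_cases hI : ∃ i j, ((Complex.I • v) i * w j).re ≠ 0
    · exact key Complex.I (him0 _) hI
    push Not at h1 hI
    obtain ⟨i, hi⟩ := Function.ne_iff.1 hv0
    obtain ⟨j, hj⟩ := Function.ne_iff.1 hw0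
    refine absurd (Complex.ext ?_ ?_) (mul_ne_zero hi hj)
    · simpa using h1 i j
    · have := hI i j
      rw [Pi.smul_apply, smul_eq_mul, mul_assoc, Complex.I_mul_re, neg_eq_zero] at this
      simpa using this
  · refine key (w ⬝ᵥ v)⁻¹ (by simp [hs]) ?_
    by_contra! h
    have h1 : w ⬝ᵥ ((w ⬝ᵥ v)⁻¹ • v) = 1 := by simp [hs]
    have h2 := congrArg Complex.re h1
    rw [dotProduct, Complex.re_sum, Finset.sum_eq_zero fun i _ => by rw [mul_comm]; exact h i i] at h2
    simp at h2

theorem Polynomial.exists_isRoot_of_odd_natDegree_real {f : Polynomial ℝ} (hf : f.Monic)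
    (hodd : Odd f.natDegree) : ∃ x, f.IsRoot x := by
  have hpos : 0 < f.natDegree := hodd.pos
  have h1 := f.tendsto_atTop_of_leadingCoeff_nonneg (Polynomial.natDegree_pos_iff_degree_pos.1 hpos)
    (by rw [hf.leadingCoeff]; exact zero_le_one)
  have hdeg : (f.comp (-Polynomial.X)).natDegree = f.natDegree := by
    simp [Polynomial.natDegree_comp]
  have h2 := (f.comp (-Polynomial.X)).tendsto_atBot_of_leadingCoeff_nonpos
    (Polynomial.natDegree_pos_iff_degree_pos.1 (hdeg ▸ hpos))
    (by
      rw [Polynomial.leadingCoeff_comp (by simp), hf.leadingCoeff]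
      simp [hodd.neg_one_pow])
  obtain ⟨a, ha⟩ := (h1.eventually_ge_atTop 0).exists
  obtain ⟨b, hb⟩ := (h2.eventually_le_atBot 0).exists
  exact mem_range_of_exists_le_of_exists_ge f.continuous
    ⟨-b, by simpa [Polynomial.eval_comp] using hb⟩ ⟨a, ha⟩

theorem Matrix.exists_rank_one_or_two_commute [NeZero n] (A : Matrix (Fin n) (Fin n) ℝ) :
    (∃ (G : Matrix (Fin n) (Fin 1) ℝ) (H : Matrix (Fin 1) (Fin n) ℝ),
      G * H ≠ 0 ∧ Commute A (G * H)) ∨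
    (Even n ∧ ∃ (G : Matrix (Fin n) (Fin 2) ℝ) (H : Matrix (Fin 2) (Fin n) ℝ) (a : ℝ),
      G * H ≠ 0 ∧ H * G = a • 1 ∧ Commute A (G * H)) := by
  by_cases h : ∃ x, A.charpoly.IsRoot x
  · exact Or.inl (Matrix.exists_rank_one_commute h.choose_spec)
  refine Or.inr ⟨?_, ?_⟩
  · by_contra hn
    refine h (Polynomial.exists_isRoot_of_odd_natDegree_real A.charpoly_monic ?_)
    rw [A.charpoly_natDegree_eq_dim, Fintype.card_fin]
    exact Nat.not_even_iff_odd.1 hn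
  · obtain ⟨x, hx⟩ := IsAlgClosed.exists_root (A.map Complex.ofReal).charpoly (by
      rw [charpoly_degree_eq_dim, Fintype.card_fin]
      exact_mod_cast NeZero.ne n)
    refine Matrix.exists_rank_two_commute hx fun him => h ⟨x.re, ?_⟩
    have hx' : ((x.re : ℝ) : ℂ) = x := Complex.ext rfl him.symm
    have hmap : (A.map Complex.ofReal).charpoly = A.charpoly.map Complex.ofRealHom :=
      A.charpoly_map Complex.ofRealHom
    rw [hmap, ← hx', Polynomial.IsRoot, show ((x.re : ℝ) : ℂ) = Complex.ofRealHom x.re from rfl,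
      Polynomial.eval_map_apply] at hx
    exact (map_eq_zero _).1 hx

/-- The inner dimensions of the factored matrices are at most two, and equal to one if `n` is odd, so
only the case `n = 4` with two factors of rank two is not covered by counting dimensions. -/
theorem longCommutingChain_real (hn : 3 ≤ n) (A B : Matrix (Fin n) (Fin n) ℝ) :
    LongCommutingChain A B := by
  have : NeZero n := ⟨by omega⟩
  rcases A.exists_rank_one_or_two_commute with ⟨G, H, hGH, hA⟩ | ⟨he, G, H, a, hGH, hHG, hA⟩ <;>
  rcases B.exists_rank_one_or_two_commute with
    ⟨G', H', hGH', hB⟩ | ⟨he', G', H', a', hGH', hHG', hB⟩ <;>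
  refine longCommutingChain_of_factors (by simp; omega) (by simp; omega) hGH hGH' hA hB ?_
  · exact exists_nonscalar_commute_of_card_lt hGH (by simp; omega)
  · refine exists_nonscalar_commute_of_card_lt hGH ?_
    obtain ⟨m, rfl⟩ := he'
    simp; omega
  · refine exists_nonscalar_commute_of_card_lt hGH ?_
    obtain ⟨m, rfl⟩ := he
    simp; omega
  · rcases eq_or_ne n 4 with rfl | hn4
    · exact exists_nonscalar_commute_four hGH hHG hHG'
    · refine exists_nonscalar_commute_of_card_lt hGH ?_
      obtain ⟨m, rfl⟩ := he
      simp; omega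

end real

/-! ### Commuting distance and commuting chains -/

section distance

variable {k : Type*} [Field k] {n : ℕ}

theorem commutingGraph_edist_le_one {X Y : {A : Matrix (Fin n) (Fin n) k // ¬ IsScalarMatrix A}}
    (h : Commute X.1 Y.1) : (commutingGraph k n).edist X Y ≤ 1 := by
  rcases eq_or_ne X Y with rfl | hne
  · simp
  · have hadj : (commutingGraph k n).Adj X Y := ⟨hne, h⟩
    exact (SimpleGraph.edist_eq_one_iff_adj.2 hadj).le

theorem commutingDist_le_four_of_longCommutingChain {A B : Matrix (Fin n) (Fin n) k}
    (h : LongCommutingChain A B) : commutingDist A B ≤ 4 := by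
  rw [commutingDist]
  split_ifs with hs hAB
  · obtain ⟨P, C, Q, hP, hC, hQ, h1, h2, h3, h4⟩ := h
    calc _ ≤ (commutingGraph k n).edist ⟨A, hs.1⟩ ⟨P, hP⟩ + (commutingGraph k n).edist ⟨P, hP⟩ ⟨C, hC⟩
          + (commutingGraph k n).edist ⟨C, hC⟩ ⟨Q, hQ⟩
          + (commutingGraph k n).edist ⟨Q, hQ⟩ ⟨B, hs.2⟩ :=
          SimpleGraph.edist_triangle.trans (add_le_add_left
            (SimpleGraph.edist_triangle.trans (add_le_add_left SimpleGraph.edist_triangle _)) _)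
      _ ≤ 1 + 1 + 1 + 1 := by
          gcongr <;> exact commutingGraph_edist_le_one ‹_›
      _ = 4 := by norm_num
  · simp
  · norm_num

/-- Consecutive terms of a commuting chain may coincide, so shorter walks are padded by repetition. -/
theorem commutingChain_of_commutingDist_le_three {A B : Matrix (Fin n) (Fin n) k}
    (hA : ¬ IsScalarMatrix A) (hB : ¬ IsScalarMatrix B) (h : commutingDist A B ≤ 3) :
    CommutingChain A B := by
  rw [commutingDist, dif_pos ⟨hA, hB⟩] at h
  have htop : (commutingGraph k n).edist ⟨A, hA⟩ ⟨B, hB⟩ ≠ ⊤ :=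
    ne_top_of_le_ne_top (by simp) h
  obtain ⟨w, hw⟩ := SimpleGraph.exists_walk_of_edist_ne_top htop
  rw [← hw] at h
  have hlen : w.length ≤ 3 := by exact_mod_cast h
  match w, hlen with
  | .nil, _ => exact ⟨A, A, hA, hA, rfl, rfl, rfl⟩
  | .cons h1 .nil, _ => exact ⟨A, A, hA, hA, rfl, rfl, h1.2⟩
  | .cons (v := C) h1 (.cons h2 .nil), _ => exact ⟨C.1, C.1, C.2, C.2, h1.2, rfl, h2.2⟩
  | .cons (v := C) h1 (.cons (v := D) h2 (.cons h3 .nil)), _ =>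
    exact ⟨C.1, D.1, C.2, D.2, h1.2, h2.2, h3.2⟩
  | .cons _ (.cons _ (.cons _ (.cons _ _))), h =>
    simp only [SimpleGraph.Walk.length_cons] at h
    omega

end distance

/-! ### The distance of a random pair -/

section random

variable {k : Type*} [NontriviallyNormedField k] [ProperSpace k]
  [SecondCountableTopology k] [MeasureSpace k] [BorelSpace k]
  [(volume : Measure k).IsAddHaarMeasure] [NullSingletonClass (volume : Measure k)]
  [NormedAlgebra k ℂ] {n : ℕ}

theorem ae_not_isScalarMatrix (hn : 2 ≤ n) :
    ∀ᵐ A : Matrix (Fin n) (Fin n) k, ¬ IsScalarMatrix A := by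
  have h01 : (⟨0, by omega⟩ : Fin n) ≠ ⟨1, by omega⟩ := by simp
  filter_upwards [MvPolynomial.ae_eval_algebraMap_ne_zero (k := k)
    (MvPolynomial.X_ne_zero ((⟨0, by omega⟩, ⟨1, by omega⟩) : Fin n × Fin n))] with A hA
  rintro ⟨c, rfl⟩
  simp [Matrix.one_apply_ne h01] at hA

theorem ae_not_commutingDist_le_three (hn : 2 ≤ n) :
    ∀ᵐ p : Matrix (Fin n) (Fin n) k × Matrix (Fin n) (Fin n) k, ¬ commutingDist p.1 p.2 ≤ 3 := by
  have : NeZero n := ⟨by omega⟩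
  have h := ae_not_isScalarMatrix (k := k) hn
  filter_upwards [ae_not_commutingChain (k := k) (n := n), Measure.quasiMeasurePreserving_fst.ae h,
    Measure.quasiMeasurePreserving_snd.ae h] with p hp h1 h2 hle
  exact hp (commutingChain_of_commutingDist_le_three h1 h2 hle)

theorem volume_commutingSet_three (hn : 2 ≤ n) : volume (commutingSet k n 3) = 0 := by
  have := ae_not_commutingDist_le_three (k := k) hn
  rw [ae_iff] at this
  simpa [commutingSet] using this

theorem ae_commutingDist_eq_four (hn : 2 ≤ n)
    (h : ∀ A B : Matrix (Fin n) (Fin n) k, LongCommutingChain A B) :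
    ∀ᵐ p : Matrix (Fin n) (Fin n) k × Matrix (Fin n) (Fin n) k, commutingDist p.1 p.2 = 4 := by
  filter_upwards [ae_not_commutingDist_le_three (k := k) hn] with p hp
  exact le_antisymm (commutingDist_le_four_of_longCommutingChain (h _ _))
    (Order.add_one_le_of_lt (not_le.1 hp))

end random

theorem mainTheorem9 :
    (∀ n : ℕ, 2 ≤ n →
      volume (commutingSet ℝ n 3) = 0 ∧ volume (commutingSet ℂ n 3) = 0) ∧
    (∀ n : ℕ, 3 ≤ n →
      (∀ᵐ p : Matrix (Fin n) (Fin n) ℝ × Matrix (Fin n) (Fin n) ℝ,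
        commutingDist p.1 p.2 = 4) ∧
      (∀ᵐ p : Matrix (Fin n) (Fin n) ℂ × Matrix (Fin n) (Fin n) ℂ,
        commutingDist p.1 p.2 = 4)) :=
  ⟨fun _ hn => ⟨volume_commutingSet_three hn, volume_commutingSet_three hn⟩, fun n hn =>
    have hn2 : 2 ≤ n := by omega
    ⟨ae_commutingDist_eq_four hn2 (longCommutingChain_real hn),
      ae_commutingDist_eq_four hn2 (longCommutingChain_of_isAlgClosed hn)⟩⟩
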